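/- Let $\Phi$ be a stationary (simple) point process on $\mathbb{R}^2$ on a probability space $(\Omega,\mathcal A,\mathbb P)$ (the base stations), let $P,W>0$, and let $\ell:[0,\infty)\to[0,\infty)$ be non-increasing. For an integer $K\ge 1$, a stationary marking of $\Phi$ by $K$ marks assigns to each $x\in\Phi$ a mark $M(x)\in\{1,\dots,K\}$ such that the law of the marked point process $\{(x,M(x)):x\in\Phi\}$ is invariant under the translations $(x,m)\mapsto(x+v,m)$, $v\in\mathbb{R}^2$. For $H_K>0$, $\Phi$ is called $(K,H_K)$-hardcore regulated if there is such a stationary marking for which, $\mathbb P$-almost surely, $\|x-y\|\ge 2H_K$ for all distinct $x,y\in\Phi$ with $M(x)=M(y)$. A $K$-slot periodic schedule is such a stationary marking; $M(x)=i$ means that $x$ transmits, with power $P$, exactly in slot $i$ of each period. Let $x_0$ be a point of $\Phi$ nearest to the origin. The SINR in slot $i$ and the normalized rate of the user at the origin, who is served by $x_0$, are $$\mathrm{SINR}_i=\frac{P\,\ell(\|x_0\|)\,\mathbf 1(M(x_0)=i)}{P\sum_{x\in\Phi\setminus\{x_0\},\,M(x)=i}\ell(\|x\|)+W},\qquad R=\frac1K\sum_{i=1}^K\log(1+\mathrm{SINR}_i).$$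 For $d\ge 0$ and $H>0$ put $t=\max(d,2H-d)$ and $$\theta(P,H)=\frac{P\ell(d)}{P\int_t^\infty\frac{2\pi\ell(r)}{\sqrt{12}}\left(\frac1H+\frac r{H^2}\right)dr+P\,\frac{\pi\ell(t)t}{\sqrt{12}}\left(\frac2H+\frac t{H^2}\right)+W}.$$ A quotient with infinite denominator is read as $0$. **Claim.** If $\Phi$ is $(K,H_K)$-hardcore regulated, then there is a $K$-slot periodic schedule $M$ (a stationary marking of $\Phi$) such that $\mathbb P$-almost surely, whenever $\|x_0\|=d$ and $M(x_0)=i$, $$\mathrm{SINR}_i\ge\theta(P,H_K)\qquad\text{and}\qquad R\ge\frac1K\log\bigl(1+\theta(P,H_K)\bigr).$$ -/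

import Mathlib

open MeasureTheory ProbabilityTheory
open scoped ENNReal

noncomputable section

namespace Cellular

/-- The Euclidean plane. -/
abbrev Plane : Type := EuclideanSpace ℝ (Fin 2)

/-- The counting measure `∑_{a ∈ A} δ_a` of a set of points `A`. -/
def countingMeasure {S : Type*} [MeasurableSpace S] (A : Set S) : Measure S :=
  Measure.sum fun a : A => Measure.dirac (a : S)

/-- A (simple) point process on the plane: a random locally finite set of points whose counting
measure is a random measure, i.e. the number of points in each Borel set is a random variable. -/
structure IsPointProcess {Ω : Type*} [MeasurableSpace Ω] (Φ : Ω → Set Plane) : Prop where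
  locallyFinite : ∀ (ω : Ω) (r : ℝ), (Φ ω ∩ Metric.ball 0 r).Finite
  measurable : Measurable fun ω => countingMeasure (Φ ω)

/-- A stationary point process: its law is invariant under all translations of the plane. -/
structure IsStationaryPointProcess {Ω : Type*} [MeasurableSpace Ω] (μ : Measure Ω)
    (Φ : Ω → Set Plane) : Prop extends IsPointProcess Φ where
  stationary : ∀ v : Plane,
    IdentDistrib (fun ω => countingMeasure ((fun x => x + v) '' Φ ω))
      (fun ω => countingMeasure (Φ ω)) μ μ

/-- The marked point set `{(x, m x) : x ∈ A}`. -/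
def markedPoints {K : ℕ} (A : Set Plane) (m : Plane → Fin K) : Set (Plane × Fin K) :=
  (fun x => (x, m x)) '' A

/-- A stationary marking of `Φ` by `K` marks: each point `x ∈ Φ ω` has a mark `M ω x` in a set of
`K` marks (the values of `M ω` off `Φ ω` play no role), and the law of the marked point process
`{(x, M x) : x ∈ Φ}` is invariant under translations, which move the points and keep the mark of
each point. -/
structure IsStationaryMarking {Ω : Type*} [MeasurableSpace Ω] (μ : Measure Ω)
    (Φ : Ω → Set Plane) {K : ℕ} (M : Ω → Plane → Fin K) : Prop where
  measurable : Measurable fun ω => countingMeasure (markedPoints (Φ ω) (M ω))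
  stationary : ∀ v : Plane,
    IdentDistrib
      (fun ω => countingMeasure
        ((fun p : Plane × Fin K => (p.1 + v, p.2)) '' markedPoints (Φ ω) (M ω)))
      (fun ω => countingMeasure (markedPoints (Φ ω) (M ω))) μ μ

/-- `(K, H)`-hardcore regulation of a stationary point process: some stationary marking by `K`
marks is such that, almost surely, any two distinct points with the same mark are at distance at
least `2H`. -/
def IsHardcoreRegulated {Ω : Type*} [MeasurableSpace Ω] (μ : Measure Ω)
    (Φ : Ω → Set Plane) (K : ℕ) (H : ℝ) : Prop :=
  IsStationaryPointProcess μ Φ ∧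
    ∃ M : Ω → Plane → Fin K, IsStationaryMarking μ Φ M ∧
      ∀ᵐ ω ∂μ, ∀ x ∈ Φ ω, ∀ y ∈ Φ ω, x ≠ y → M ω x = M ω y → 2 * H ≤ dist x y

/-- `x₀` is a point of `A` nearest to the origin (the base station serving the user there). -/
def IsServing (A : Set Plane) (x₀ : Plane) : Prop :=
  x₀ ∈ A ∧ ∀ x ∈ A, ‖x₀‖ ≤ ‖x‖

/-- The total attenuation, possibly infinite, at the origin from the points of `A` other than
`x₀` that are active in slot `i`, i.e. that have mark `i`. -/
def interference (ℓ : ℝ → ℝ) {K : ℕ} (A : Set Plane) (m : Plane → Fin K) (x₀ : Plane)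
    (i : Fin K) : ℝ≥0∞ :=
  ∑' x : {x : Plane // x ∈ A ∧ x ≠ x₀ ∧ m x = i}, ENNReal.ofReal (ℓ ‖(x : Plane)‖)

open Classical in
/-- The SINR in slot `i` of the user at the origin served by `x₀`. For noise power `W > 0` the
denominator is positive; if the interference is infinite, the SINR is `0`. -/
def sinr (P W : ℝ) (ℓ : ℝ → ℝ) {K : ℕ} (A : Set Plane) (m : Plane → Fin K) (x₀ : Plane)
    (i : Fin K) : ℝ :=
  (ENNReal.ofReal (P * ℓ ‖x₀‖ * (if m x₀ = i then 1 else 0)) /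
    (ENNReal.ofReal P * interference ℓ A m x₀ i + ENNReal.ofReal W)).toReal

/-- The normalized rate over a period of `K` slots. -/
def normalizedRate (P W : ℝ) (ℓ : ℝ → ℝ) {K : ℕ} (A : Set Plane) (m : Plane → Fin K)
    (x₀ : Plane) : ℝ :=
  (1 / (K : ℝ)) * ∑ i : Fin K, Real.log (1 + sinr P W ℓ A m x₀ i)

/-- The guaranteed SINR `θ(P, H)` at distance `d` from the serving base station, with
`t = max d (2H - d)`. The integral may be infinite, and then `θ(P, H) = 0`. -/
def theta (W : ℝ) (ℓ : ℝ → ℝ) (d P H : ℝ) : ℝ :=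
  let t := max d (2 * H - d)
  (ENNReal.ofReal (P * ℓ d) /
    (ENNReal.ofReal P *
        (∫⁻ r in Set.Ioi t,
          ENNReal.ofReal (2 * Real.pi * ℓ r / Real.sqrt 12 * (1 / H + r / H ^ 2))) +
      ENNReal.ofReal (P * (Real.pi * ℓ t * t / Real.sqrt 12 * (2 / H + t / H ^ 2))) +
      ENNReal.ofReal W)).toReal

end Cellular

end

open Cellular

/-! The hardcore marking given by the hypothesis is itself the schedule, so the claim is
deterministic: bound the interference from the points sharing the mark of `x₀`. These lie at
distance at least `d` from the origin, since `x₀` is nearest, and at least `2H - d` by the triangle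
inequality, hence at least `t`. A packing bound limits the number of points of one mark within
distance `r ≥ H` to `π / √12 * (1 + r / H) ^ 2` (`card_le_of_separated`). Discounting `x₀` leaves at
most `F r = π / √12 * (2 r / H + r² / H²)` interferers, and summation by parts
(`sum_add_le_integral`) gives `ℓ t * F t + ∫ ℓ F'`, the expression in `theta`.

The packing bound is Thue's theorem with a boundary: after scaling, every Voronoi cell cut by the
disc of radius `R` has area at least `√12`, that of the regular hexagon about the unit disc
(`sqrt_twelve_le_volume_cell`). In polar coordinates about the centre, the squared radius of the
cell is compared with the constant `c = √12 / π`, whose integral gives exactly `√12`. A neighbour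
matters only in the directions of the cap its bisector cuts from the disc of radius `2 / √3`. Caps
are disjoint in direction, and each contributes a nonnegative excess over `c`
(`integral_capDefect_nonneg`). If the bounding circle comes nearer than `2 / √3`, the directions
`|φ| < 4 / 5` towards it meet no cap, and there too the mean excess is nonnegative. -/

/-! ### Area in polar coordinates. -/

/-- If a radial function `√(G φ)` stays inside `E`, then `∫ G / 2` bounds the area of `E` below. -/
theorem ofReal_integral_half_le_volume {E : Set ℂ} (hE : MeasurableSet E) {G : ℝ → ℝ}
    (hG : IntegrableOn G (Set.Ioo (-Real.pi) Real.pi))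
    (h : ∀ φ ∈ Set.Ioo (-Real.pi) Real.pi, ∀ s : ℝ, 0 < s → s ^ 2 < G φ →
      (s : ℂ) * (Real.cos φ + Real.sin φ * Complex.I) ∈ E) :
    ENNReal.ofReal (∫ φ in Set.Ioo (-Real.pi) Real.pi, G φ / 2) ≤ volume E := by
  have hinner : ∀ φ ∈ Set.Ioo (-Real.pi) Real.pi, ENNReal.ofReal (max (G φ / 2) 0) ≤
      ∫⁻ s in Set.Ioi (0 : ℝ), ENNReal.ofReal s *
        E.indicator 1 ((s : ℂ) * (Real.cos φ + Real.sin φ * Complex.I)) := by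
    intro φ hφ
    rcases le_or_gt (G φ) 0 with h0 | h0
    · rw [max_eq_right (by linarith)]; simp
    rw [max_eq_left (by linarith)]
    have h1 : ENNReal.ofReal (G φ / 2) =
        ∫⁻ s in Set.Ioo (0 : ℝ) (Real.sqrt (G φ)), ENNReal.ofReal s := by
      rw [setLIntegral_congr (Ioo_ae_eq_Ioc), ← ofReal_integral_eq_lintegral_ofReal]
      · rw [← intervalIntegral.integral_of_le (Real.sqrt_nonneg _), integral_id,
          Real.sq_sqrt h0.le]
        simp
      · exact (continuous_id.integrableOn_Icc (a := (0 : ℝ))).mono_set Set.Ioc_subset_Icc_self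
      · filter_upwards [ae_restrict_mem measurableSet_Ioc] with s hs using hs.1.le
    rw [h1]
    calc _ = ∫⁻ s in Set.Ioo (0 : ℝ) (Real.sqrt (G φ)), ENNReal.ofReal s *
          E.indicator 1 ((s : ℂ) * (Real.cos φ + Real.sin φ * Complex.I)) := by
            refine setLIntegral_congr_fun measurableSet_Ioo fun s hs => ?_
            have : (s : ℂ) * (Real.cos φ + Real.sin φ * Complex.I) ∈ E :=
              h φ hφ s hs.1 ((Real.lt_sqrt hs.1.le).1 hs.2)
            simp only [Set.indicator_of_mem this, Pi.one_apply, mul_one]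
      _ ≤ _ := lintegral_mono_set Set.Ioo_subset_Ioi_self
  calc ENNReal.ofReal (∫ φ in Set.Ioo (-Real.pi) Real.pi, G φ / 2)
      ≤ ENNReal.ofReal (∫ φ in Set.Ioo (-Real.pi) Real.pi, max (G φ / 2) 0) :=
        ENNReal.ofReal_le_ofReal (integral_mono (hG.div_const 2)
          (hG.div_const 2).pos_part fun φ => le_max_left _ _)
    _ = ∫⁻ φ in Set.Ioo (-Real.pi) Real.pi, ENNReal.ofReal (max (G φ / 2) 0) :=
        ofReal_integral_eq_lintegral_ofReal (hG.div_const 2).pos_part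
          (Filter.Eventually.of_forall fun φ => le_max_right _ _)
    _ ≤ ∫⁻ φ in Set.Ioo (-Real.pi) Real.pi, ∫⁻ s in Set.Ioi (0 : ℝ), ENNReal.ofReal s *
        E.indicator 1 ((s : ℂ) * (Real.cos φ + Real.sin φ * Complex.I)) :=
        setLIntegral_mono' measurableSet_Ioo hinner
    _ = volume E := by
        rw [← lintegral_indicator_one hE, ← Complex.lintegral_comp_polarCoord_symm,
          polarCoord_target, Measure.volume_eq_prod, ← Measure.prod_restrict,
          lintegral_prod_symm']
        · simp [Complex.polarCoord_symm_apply]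
        · refine Measurable.smul (ENNReal.measurable_ofReal.comp measurable_fst) ((measurable_const.indicator hE).comp ?_)
          have : Measurable fun p : ℝ × ℝ =>
              (p.1 : ℂ) * (Real.cos p.2 + Real.sin p.2 * Complex.I) := by fun_prop
          exact (funext fun p => (Complex.polarCoord_symm_apply p).symm : _ = _) ▸ this

/-! ### Excess area over one cap. -/

/-- The density `√12 / π` compared with `h² / cos² θ` over the cap cut off from the disc of
radius `2 / √3` by a line at distance `h` from its centre. -/
noncomputable def capDefect (h θ : ℝ) : ℝ :=
  if Real.sqrt 3 * h < 2 * Real.cos θ then h ^ 2 / Real.cos θ ^ 2 - Real.sqrt 12 / Real.pi else 0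

theorem sqrt_twelve : Real.sqrt 12 = 2 * Real.sqrt 3 := by
  rw [show (12 : ℝ) = 2 ^ 2 * 3 by norm_num, Real.sqrt_mul (by norm_num), Real.sqrt_sq (by norm_num)]

theorem measurable_capDefect (h : ℝ) : Measurable (capDefect h) := by
  unfold capDefect
  exact Measurable.ite (measurableSet_lt (by fun_prop) (by fun_prop)) (by fun_prop) (by fun_prop)

theorem abs_capDefect_le {h : ℝ} (hh : 0 ≤ h) (θ : ℝ) :
    |capDefect h θ| ≤ 4 / 3 + Real.sqrt 12 / Real.pi := by
  have hc : 0 ≤ Real.sqrt 12 / Real.pi := by positivity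
  unfold capDefect
  split_ifs with hθ
  · have h3 : Real.sqrt 3 ^ 2 = 3 := Real.sq_sqrt (by norm_num)
    have hpos : 0 < Real.cos θ := by nlinarith [mul_nonneg (Real.sqrt_nonneg 3) hh]
    have : h ^ 2 / Real.cos θ ^ 2 ≤ 4 / 3 := by
      rw [div_le_iff₀ (by positivity)]
      nlinarith [mul_nonneg (Real.sqrt_nonneg 3) hh]
    have h0 : 0 ≤ h ^ 2 / Real.cos θ ^ 2 := by positivity
    rw [abs_le]; constructor <;> linarith
  · simp; positivity

theorem intervalIntegrable_capDefect {h : ℝ} (hh : 0 ≤ h) (ψ a b : ℝ) :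
    IntervalIntegrable (fun φ => capDefect h (φ - ψ)) volume a b := by
  refine (intervalIntegrable_const (c := 4 / 3 + Real.sqrt 12 / Real.pi)).mono_fun
    ((measurable_capDefect h).comp (measurable_id.sub_const ψ)).aestronglyMeasurable ?_
  refine Filter.Eventually.of_forall fun φ => ?_
  simp only [Real.norm_eq_abs]
  exact (abs_capDefect_le hh _).trans (le_abs_self _)

/-- Concavity of `sin` puts the chord from `0` to `π / 3` below the graph at `2 * α`. Equality at `α
= π / 6` is the regular hexagon. -/
theorem mul_le_sin_two_mul {α : ℝ} (h0 : 0 ≤ α) (h1 : α ≤ Real.pi / 6) :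
    Real.sqrt 12 / Real.pi * α ≤ 4 / 3 * (Real.sin α * Real.cos α) := by
  have hpi := Real.pi_pos
  have hconc := (strictConcaveOn_sin_Icc.concaveOn).2
    (show (0 : ℝ) ∈ Set.Icc 0 Real.pi from ⟨le_rfl, hpi.le⟩)
    (show Real.pi / 3 ∈ Set.Icc 0 Real.pi from ⟨by positivity, by linarith⟩)
    (show 0 ≤ 1 - 6 * α / Real.pi by rw [sub_nonneg, div_le_one hpi]; linarith)
    (show 0 ≤ 6 * α / Real.pi by positivity) (by ring)
  have e : (1 - 6 * α / Real.pi) • (0 : ℝ) + (6 * α / Real.pi) • (Real.pi / 3) = 2 * α := by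
    simp only [smul_eq_mul]; field_simp; ring
  rw [e, Real.sin_two_mul, Real.sin_pi_div_three, Real.sin_zero] at hconc
  simp only [smul_eq_mul, mul_zero, zero_add] at hconc
  rw [sqrt_twelve]
  have : 2 * Real.sqrt 3 / Real.pi * α = 2 / 3 * (6 * α / Real.pi * (Real.sqrt 3 / 2)) := by
    field_simp; ring
  rw [this]; linarith

/-- With `cos α = √3 * h / 2` the cap has half-angle `α`, and the integral is `2 * (h² tan α - c α)`
with `c = √12 / π`. Here `h² tan α = 4 / 3 * sin α cos α`, and `h ≥ 1` forces `α ≤ π / 6`. For `h ≥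
2 / √3` the cap is empty. -/
theorem integral_capDefect_nonneg {h : ℝ} (hh : 1 ≤ h) (ψ : ℝ) :
    0 ≤ ∫ φ in (-Real.pi)..Real.pi, capDefect h (φ - ψ) := by
  have hpi := Real.pi_pos
  have hper : Function.Periodic (capDefect h) (2 * Real.pi) := by
    intro θ; simp only [capDefect, Real.cos_add_two_pi]
  have hshift : ∫ φ in (-Real.pi)..Real.pi, capDefect h (φ - ψ) =
      ∫ φ in (-Real.pi)..Real.pi, capDefect h φ := by
    rw [intervalIntegral.integral_comp_sub_right (capDefect h)]
    have := hper.intervalIntegral_add_eq (-Real.pi - ψ) (-Real.pi)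
    convert this using 2 <;> ring
  rw [hshift]
  have h3 : Real.sqrt 3 ^ 2 = 3 := Real.sq_sqrt (by norm_num)
  have h3p : 0 < Real.sqrt 3 := by positivity
  by_cases hlt : Real.sqrt 3 * h < 2
  swap
  · have : capDefect h = 0 := by
      funext θ
      rw [capDefect, if_neg]; · rfl
      linarith [Real.cos_le_one θ]
    simp [this]
  set k := Real.sqrt 3 * h / 2 with hk
  have hk1 : k < 1 := by rw [hk]; linarith
  have hk0 : Real.sqrt 3 / 2 ≤ k := by rw [hk]; nlinarith
  set α := Real.arccos k with hα
  have hcosα : Real.cos α = k := Real.cos_arccos (by linarith) hk1.le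
  have hα0 : 0 < α := Real.arccos_pos.2 hk1
  have hα1 : α ≤ Real.pi / 6 := by
    by_contra! hcon
    have := Real.cos_lt_cos_of_nonneg_of_le_pi (by positivity) (Real.arccos_le_pi k) hcon
    rw [← hα, hcosα, Real.cos_pi_div_six] at this
    linarith
  have hind : Set.EqOn (capDefect h) ((Set.Ioo (-α) α).indicator
      fun θ => h ^ 2 / Real.cos θ ^ 2 - Real.sqrt 12 / Real.pi) (Set.Ioc (-Real.pi) Real.pi) := by
    intro θ hθ
    have habs : |θ| ≤ Real.pi := abs_le.2 ⟨hθ.1.le, hθ.2⟩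
    have hiff : Real.sqrt 3 * h < 2 * Real.cos θ ↔ θ ∈ Set.Ioo (-α) α := by
      rw [Set.mem_Ioo, ← abs_lt,
        show Real.sqrt 3 * h = 2 * Real.cos α by rw [hcosα, hk]; ring, ← Real.cos_abs θ]
      constructor
      · intro hc
        by_contra! hcon
        linarith [Real.cos_le_cos_of_nonneg_of_le_pi hα0.le habs hcon]
      · intro hc
        linarith [Real.cos_lt_cos_of_nonneg_of_le_pi (abs_nonneg θ) (Real.arccos_le_pi k) hc]
    by_cases hm : θ ∈ Set.Ioo (-α) α
    · rw [Set.indicator_of_mem hm, capDefect, if_pos (hiff.2 hm)]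
    · rw [Set.indicator_of_notMem hm, capDefect, if_neg (fun hc => hm (hiff.1 hc))]
  rw [intervalIntegral.integral_of_le (by linarith), setIntegral_congr_fun measurableSet_Ioc hind,
    setIntegral_indicator measurableSet_Ioo, Set.inter_eq_right.2
      (show Set.Ioo (-α) α ⊆ Set.Ioc (-Real.pi) Real.pi from
        fun x hx => ⟨by linarith [hx.1], by linarith [hx.2]⟩),
    setIntegral_congr_set Ioo_ae_eq_Ioc, ← intervalIntegral.integral_of_le (by linarith)]
  have hcos : ∀ θ ∈ Set.uIcc (-α) α, 0 < Real.cos θ := by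
    intro θ hθ
    rw [Set.uIcc_of_le (by linarith)] at hθ
    exact Real.cos_pos_of_mem_Ioo ⟨by linarith [hθ.1], by linarith [hθ.2]⟩
  have hderiv : ∀ θ ∈ Set.uIcc (-α) α,
      HasDerivAt (fun θ => h ^ 2 * Real.tan θ - Real.sqrt 12 / Real.pi * θ)
        (h ^ 2 / Real.cos θ ^ 2 - Real.sqrt 12 / Real.pi) θ := by
    intro θ hθ
    have h1 := ((Real.hasDerivAt_tan (hcos θ hθ).ne').const_mul (h ^ 2)).sub
      ((hasDerivAt_id θ).const_mul (Real.sqrt 12 / Real.pi))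
    exact h1.congr_deriv (by ring)
  rw [intervalIntegral.integral_eq_sub_of_hasDerivAt hderiv
    (ContinuousOn.intervalIntegrable (by
      refine ContinuousOn.sub (ContinuousOn.div (by fun_prop) (by fun_prop) ?_) (by fun_prop)
      exact fun θ hθ => (pow_pos (hcos θ hθ) 2).ne'))]
  have hsin := mul_le_sin_two_mul hα0.le hα1
  have htan : h ^ 2 * Real.tan α = 4 / 3 * (Real.sin α * Real.cos α) := by
    have hc : Real.cos α ≠ 0 := by rw [hcosα]; positivity
    have hh2 : h ^ 2 = 4 / 3 * Real.cos α ^ 2 := by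
      rw [hcosα, hk]; field_simp; rw [h3]; ring
    rw [hh2, Real.tan_eq_sin_div_cos]; field_simp
  rw [Real.tan_neg]
  nlinarith

/-! ### Bisectors and caps seen from the centre of a cell. -/

theorem norm_mul_cos_sub_arg (v : ℂ) (φ : ℝ) :
    ‖v‖ * Real.cos (φ - v.arg) = v.re * Real.cos φ + v.im * Real.sin φ := by
  rw [Real.cos_sub, ← Complex.norm_mul_cos_arg v, ← Complex.norm_mul_sin_arg v]; ring

/-- The direction `φ` meets the cap at `2 / √3` cut off by the bisector of `0` and `v`. -/
theorem cap_iff {v : ℂ} (hv : 0 < ‖v‖) (φ : ℝ) :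
    Real.sqrt 3 * (‖v‖ / 2) < 2 * Real.cos (φ - v.arg) ↔
      Real.sqrt 3 * ‖v‖ ^ 2 < 4 * (v.re * Real.cos φ + v.im * Real.sin φ) := by
  rw [← norm_mul_cos_sub_arg]
  constructor
  · intro h; nlinarith
  · intro h
    by_contra! hc
    nlinarith

theorem sq_norm (z : ℂ) : ‖z‖ ^ 2 = z.re ^ 2 + z.im ^ 2 := by
  rw [Complex.sq_norm, Complex.normSq_apply]; ring

/-- If both caps met direction `φ`, the point `p` at distance `2 / √3` in that direction would be
strictly closer to `v` and `w` than to `0`. The squared distances among `0`, `v`, `w` sum to three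
times the squared distances to `p` minus `‖v + w - 3 p‖²`, hence to less than `12`; but each is at
least `4`. -/
theorem caps_disjoint {v w : ℂ} (hv : 2 ≤ ‖v‖) (hw : 2 ≤ ‖w‖) (hvw : 2 ≤ ‖v - w‖) {φ : ℝ}
    (h1 : Real.sqrt 3 * (‖v‖ / 2) < 2 * Real.cos (φ - v.arg))
    (h2 : Real.sqrt 3 * (‖w‖ / 2) < 2 * Real.cos (φ - w.arg)) : False := by
  rw [cap_iff (by linarith)] at h1 h2
  have e3 : Real.sqrt 3 ^ 2 = 3 := Real.sq_sqrt (by norm_num)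
  have h3p : 0 < Real.sqrt 3 := by positivity
  have hv2 : 4 ≤ ‖v‖ ^ 2 := by nlinarith
  have hw2 : 4 ≤ ‖w‖ ^ 2 := by nlinarith
  have hvw2 : 4 ≤ ‖v - w‖ ^ 2 := by nlinarith
  have h1' := mul_lt_mul_of_pos_left h1 h3p
  have h2' := mul_lt_mul_of_pos_left h2 h3p
  rw [← mul_assoc, ← sq, e3] at h1' h2'
  rw [sq_norm] at *
  simp only [Complex.sub_re, Complex.sub_im] at hvw2
  have hcs := Real.sin_sq_add_cos_sq φ
  set c := Real.cos φ
  set s := Real.sin φ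
  set t := Real.sqrt 3
  -- The two squares are the coordinates of `v + w - 3 p`, where `3 p = 2√3 * (cos φ, sin φ)`.
  nlinarith [sq_nonneg (v.re + w.re - 2 * t * c), sq_nonneg (v.im + w.im - 2 * t * s)]

theorem re_polar (s φ : ℝ) :
    ((s : ℂ) * (Real.cos φ + Real.sin φ * Complex.I)).re = s * Real.cos φ := by
  rw [Complex.re_ofReal_mul, Complex.add_re, Complex.re_ofReal_mul, Complex.ofReal_re]; simp

theorem im_polar (s φ : ℝ) :
    ((s : ℂ) * (Real.cos φ + Real.sin φ * Complex.I)).im = s * Real.sin φ := by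
  rw [Complex.im_ofReal_mul, Complex.add_im, Complex.im_ofReal_mul, Complex.ofReal_im]; simp

theorem norm_lt_norm_sub_iff (s : ℝ) (v : ℂ) (φ : ℝ) :
    ‖(s : ℂ) * (Real.cos φ + Real.sin φ * Complex.I)‖ <
        ‖(s : ℂ) * (Real.cos φ + Real.sin φ * Complex.I) - v‖ ↔
      2 * s * (v.re * Real.cos φ + v.im * Real.sin φ) < ‖v‖ ^ 2 := by
  rw [← pow_lt_pow_iff_left₀ (norm_nonneg _) (norm_nonneg _) two_ne_zero, sq_norm, sq_norm, sq_norm,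
    Complex.sub_re, Complex.sub_im, re_polar, im_polar]
  constructor <;> intro h <;> linarith

/-- The ray in direction `φ` meets the bisector of `0` and `v` at distance `(‖v‖ / 2) / cos (φ - arg
v)`. -/
theorem norm_lt_norm_sub_of_cap {v : ℂ} (hv : 2 ≤ ‖v‖) {φ s : ℝ}
    (h : Real.sqrt 3 * (‖v‖ / 2) < 2 * Real.cos (φ - v.arg))
    (hs2 : s ^ 2 < (‖v‖ / 2) ^ 2 / Real.cos (φ - v.arg) ^ 2) :
    ‖(s : ℂ) * (Real.cos φ + Real.sin φ * Complex.I)‖ <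
        ‖(s : ℂ) * (Real.cos φ + Real.sin φ * Complex.I) - v‖ := by
  rw [norm_lt_norm_sub_iff, ← norm_mul_cos_sub_arg]
  have hc : 0 < Real.cos (φ - v.arg) := by
    have : 0 ≤ Real.sqrt 3 * (‖v‖ / 2) := by positivity
    linarith
  rw [lt_div_iff₀ (by positivity), ← mul_pow] at hs2
  have := lt_of_pow_lt_pow_left₀ 2 (by positivity) hs2
  nlinarith

theorem norm_lt_norm_sub_of_not_cap {v : ℂ} (hv : 2 ≤ ‖v‖) {φ s : ℝ} (hs : 0 < s)
    (h : ¬ Real.sqrt 3 * (‖v‖ / 2) < 2 * Real.cos (φ - v.arg)) (hs2 : s ^ 2 < 4 / 3) :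
    ‖(s : ℂ) * (Real.cos φ + Real.sin φ * Complex.I)‖ <
        ‖(s : ℂ) * (Real.cos φ + Real.sin φ * Complex.I) - v‖ := by
  rw [norm_lt_norm_sub_iff]
  rw [cap_iff (by linarith), not_lt] at h
  have e3 : Real.sqrt 3 ^ 2 = 3 := Real.sq_sqrt (by norm_num)
  have h3 : s * Real.sqrt 3 < 2 := by
    refine lt_of_pow_lt_pow_left₀ 2 (by norm_num) ?_
    rw [mul_pow, e3]; linarith
  have := mul_le_mul_of_nonneg_left h hs.le
  have hv2 : 0 < ‖v‖ ^ 2 := by positivity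
  nlinarith

/-! ### Effect of the bounding circle. -/

/-- The critical case is `a = 1`, `R = 2`, where the hypothesis `s² + 2 s cos φ ≤ 3` is exactly the
conclusion squared. -/
theorem norm_add_le_of_sq_add_le {a R s φ : ℝ} (hR : 2 ≤ R) (ha : 0 ≤ a) (haR : a ≤ R - 1)
    (hs2 : s ^ 2 ≤ 4 / 3) (h : s ^ 2 + 2 * (s * Real.cos φ) ≤ 3) :
    ‖(s : ℂ) * (Real.cos φ + Real.sin φ * Complex.I) + a‖ ≤ R := by
  refine le_of_sq_le_sq ?_ (by linarith)
  rw [sq_norm, Complex.add_re, Complex.add_im, re_polar, im_polar, Complex.ofReal_re,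
    Complex.ofReal_im, add_zero]
  have hcs := Real.sin_sq_add_cos_sq φ
  set c := Real.cos φ
  set t := s * c with ht
  have e : (t + a) ^ 2 + (s * Real.sin φ) ^ 2 = s ^ 2 + 2 * a * t + a ^ 2 := by
    rw [ht]; linear_combination s ^ 2 * hcs
  rw [e]
  rcases le_or_gt t 0 with h0 | h0
  · nlinarith
  · have hts : t ^ 2 ≤ s ^ 2 := by rw [ht]; nlinarith [sq_nonneg (Real.sin φ)]
    have ht1 : t ≤ 1 := by nlinarith
    nlinarith

/-- On the curve `s² + 2 s cos φ = 3`, the expansion of `s²` at `φ = 0` begins `1 + φ² / 2`. As the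
comparison is an equality to that order, the quartic bound on `cos` is needed. -/
theorem sq_add_two_mul_cos_le_of_small {s φ : ℝ} (hφ : |φ| < 4 / 5)
    (h : s ^ 2 < 1 + φ ^ 2 / 2) : s ^ 2 + 2 * (s * Real.cos φ) ≤ 3 := by
  have hb := (abs_le.1 (Real.cos_bound (x := φ) (by linarith))).2
  have hu : φ ^ 2 ≤ 16 / 25 := by rw [← sq_abs]; nlinarith [abs_nonneg φ]
  have h4 : |φ| ^ 4 = (φ ^ 2) ^ 2 := by rw [← sq_abs φ]; ring
  rw [h4] at hb
  have hc0 := Real.one_sub_sq_div_two_le_cos (x := φ)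
  set u := φ ^ 2
  have hu0 : 0 ≤ u := sq_nonneg φ
  have hcc : Real.cos φ ^ 2 ≤ (1 - u / 2 + u ^ 2 * (5 / 96)) ^ 2 :=
    pow_le_pow_left₀ (by linarith) (by linarith) 2
  have hmain : (1 + u / 2) * (1 - u / 2 + u ^ 2 * (5 / 96)) ^ 2 ≤ (1 - u / 4) ^ 2 := by
    nlinarith [mul_nonneg (pow_nonneg hu0 2) (sub_nonneg.2 hu),
      mul_nonneg (pow_nonneg hu0 4) (sub_nonneg.2 hu), pow_nonneg hu0 2, pow_nonneg hu0 4]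
  have : s * Real.cos φ ≤ 1 - u / 4 := by
    refine le_of_sq_le_sq ?_ (by linarith)
    rw [mul_pow]
    nlinarith [sq_nonneg (Real.cos φ)]
  linarith

theorem sq_add_two_mul_cos_le_of_large {s φ : ℝ} (hs : 0 < s) (hφ : 4 / 5 ≤ |φ|)
    (hφ' : |φ| ≤ Real.pi) (h : s ^ 2 < 4 / 3) : s ^ 2 + 2 * (s * Real.cos φ) ≤ 3 := by
  have hb := (abs_le.1 (Real.cos_bound (x := 4 / 5) (by norm_num [abs_of_pos]))).2
  rw [abs_of_pos (by norm_num)] at hb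
  have hc := Real.cos_le_cos_of_nonneg_of_le_pi (by norm_num) hφ' hφ
  rw [Real.cos_abs] at hc
  have hs1 : s ≤ 1.155 := by nlinarith
  have hc' : Real.cos φ ≤ 0.702 := by norm_num at hb ⊢; linarith
  nlinarith

/-- A circle this close leaves neighbours little room ahead: `v.re ≤ R - 1 - a < 0.155`. So the
component of `v` along `φ` is at most `0.155 + 0.734 * ‖v‖`, too small for a cap when `‖v‖ ≥ 2`. -/
theorem not_cap_of_boundary {v : ℂ} {a R φ : ℝ} (hv : 2 ≤ ‖v‖) (hvR : ‖v + a‖ ≤ R - 1)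
    (hb : Real.sqrt 3 * (R - a) < 2) (hφ : |φ| < 4 / 5) :
    ¬ Real.sqrt 3 * (‖v‖ / 2) < 2 * Real.cos (φ - v.arg) := by
  rw [cap_iff (by linarith), not_lt]
  have e3 : 1.732 < Real.sqrt 3 := Real.lt_sqrt_of_sq_lt (by norm_num)
  have hu : φ ^ 2 ≤ 16 / 25 := by rw [← sq_abs]; nlinarith [abs_nonneg φ]
  have hc0 := Real.one_sub_sq_div_two_le_cos (x := φ)
  have hc1 := Real.cos_le_one φ
  have hre : v.re + a ≤ R - 1 := by
    refine le_trans ?_ ((Complex.re_le_norm _).trans hvR); simp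
  have hRa : R - a < 1.155 := by
    by_contra! hcon; nlinarith
  have hv1 : v.re * Real.cos φ ≤ 0.155 := by
    rcases le_or_gt v.re 0 with h0 | h0
    · nlinarith
    · nlinarith
  have hsin : |Real.sin φ| ≤ 0.734 := by
    refine abs_le_of_sq_le_sq ?_ (by norm_num)
    nlinarith [Real.sin_sq_add_cos_sq φ]
  have hv2 : v.im * Real.sin φ ≤ ‖v‖ * 0.734 := by
    refine (le_abs_self _).trans ?_
    rw [abs_mul]
    exact mul_le_mul (Complex.abs_im_le_norm v) hsin (abs_nonneg _) (norm_nonneg _)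
  nlinarith

/-! ### Area of a truncated Voronoi cell and the packing bound. -/

/-- The cell is centred at `0` and the bounding disc at `-a`, so the circle is nearest in direction
`φ = 0`. The squared radius is bounded below by `G = c + F + B`, where `F` collects the caps and `B`
corrects for the circle; both have nonnegative integral. -/
theorem sqrt_twelve_le_volume_cell (T : Finset ℂ) {a R : ℝ} (hR : 2 ≤ R) (ha : 0 ≤ a)
    (haR : a ≤ R - 1) (hT : ∀ v ∈ T, 2 ≤ ‖v‖) (hTT : ∀ v ∈ T, ∀ w ∈ T, v ≠ w → 2 ≤ ‖v - w‖)
    (hTR : ∀ v ∈ T, ‖v + a‖ ≤ R - 1) :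
    ENNReal.ofReal (Real.sqrt 12) ≤
      volume {q : ℂ | ‖q + a‖ ≤ R ∧ ∀ v ∈ T, ‖q‖ < ‖q - v‖} := by
  classical
  have hpi := Real.pi_pos
  set c := Real.sqrt 12 / Real.pi with hc
  have hs12 : Real.sqrt 12 < 3.4642 := (Real.sqrt_lt' (by norm_num)).2 (by norm_num)
  have hc1 : c < 1.1066 := by
    rw [hc, div_lt_iff₀ hpi]; nlinarith [Real.pi_gt_d4]
  set F : ℝ → ℝ := fun φ => ∑ v ∈ T, capDefect (‖v‖ / 2) (φ - v.arg) with hF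
  -- The angle `4 / 5` is large enough for `1 + φ² / 2` to average at least `c`, and also for the
  -- disc of radius `2 / √3` to stay inside the bounding circle in all remaining directions.
  set B : ℝ → ℝ := (Set.Ioo (-(4 / 5)) (4 / 5)).indicator
    (fun φ => if Real.sqrt 3 * (R - a) < 2 then 1 + φ ^ 2 / 2 - c else 0) with hB
  have hFint : IntervalIntegrable F volume (-Real.pi) Real.pi := by
    have hsum : F = ∑ v ∈ T, fun φ => capDefect (‖v‖ / 2) (φ - v.arg) := by
      funext φ; simp [hF]
    rw [hsum]
    exact IntervalIntegrable.sum T fun v _ => intervalIntegrable_capDefect (by positivity) _ _ _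
  have hFnn : 0 ≤ ∫ φ in (-Real.pi)..Real.pi, F φ := by
    rw [hF, intervalIntegral.integral_finsetSum
      (fun v _ => intervalIntegrable_capDefect (by positivity) v.arg _ _)]
    exact Finset.sum_nonneg fun v hv => integral_capDefect_nonneg (by linarith [hT v hv]) _
  have hBcont : Continuous fun φ : ℝ => if Real.sqrt 3 * (R - a) < 2 then 1 + φ ^ 2 / 2 - c else 0 := by
    split_ifs <;> fun_prop
  have hBint : IntervalIntegrable B volume (-Real.pi) Real.pi := by
    rw [intervalIntegrable_iff_integrableOn_Ioc_of_le (by linarith)]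
    exact (hBcont.integrableOn_Ioc).indicator measurableSet_Ioo
  have hBnn : 0 ≤ ∫ φ in (-Real.pi)..Real.pi, B φ := by
    rw [intervalIntegral.integral_of_le (by linarith), hB, setIntegral_indicator measurableSet_Ioo,
      Set.inter_eq_right.2 (show Set.Ioo (-(4 / 5) : ℝ) (4 / 5) ⊆ Set.Ioc (-Real.pi) Real.pi from
        fun x hx => ⟨by linarith [hx.1, Real.pi_gt_three], by linarith [hx.2, Real.pi_gt_three]⟩),
      setIntegral_congr_set Ioo_ae_eq_Ioc, ← intervalIntegral.integral_of_le (by norm_num)]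
    split_ifs
    · have : ∫ φ in (-(4 / 5) : ℝ)..(4 / 5), (1 + φ ^ 2 / 2 - c) =
          8 / 5 * (1 - c) + (4 / 5) ^ 3 / 3 := by
        rw [intervalIntegral.integral_sub (Continuous.intervalIntegrable (by fun_prop) _ _) (by simp),
          intervalIntegral.integral_add (by simp) (Continuous.intervalIntegrable (by fun_prop) _ _)]
        simp; ring
      -- The margin is thin: `8 / 5 * (1 - c) + (4 / 5) ^ 3 / 3` is positive at `c = 1.1066` by
      -- about `10⁻⁴`.
      rw [this]; norm_num at hc1 ⊢; linarith
    · simp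
  set G : ℝ → ℝ := fun φ => c + F φ + B φ with hG
  have hE : MeasurableSet {q : ℂ | ‖q + a‖ ≤ R ∧ ∀ v ∈ T, ‖q‖ < ‖q - v‖} := by
    have hset : {q : ℂ | ‖q + a‖ ≤ R ∧ ∀ v ∈ T, ‖q‖ < ‖q - v‖} =
        {q : ℂ | ‖q + a‖ ≤ R} ∩ ⋂ v ∈ T, {q : ℂ | ‖q‖ < ‖q - v‖} := by ext q; simp
    rw [hset]
    exact (measurableSet_le (by fun_prop) (by fun_prop)).inter
      (Finset.measurableSet_biInter T fun v _ => measurableSet_lt (by fun_prop) (by fun_prop))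
  have hGint : IntervalIntegrable G volume (-Real.pi) Real.pi :=
    (intervalIntegrable_const.add hFint).add hBint
  refine le_trans (ENNReal.ofReal_le_ofReal ?_) (ofReal_integral_half_le_volume hE (G := G) ?_ ?_)
  · rw [setIntegral_congr_set Ioo_ae_eq_Ioc, ← intervalIntegral.integral_of_le (by linarith),
      intervalIntegral.integral_div, hG, intervalIntegral.integral_add
        (intervalIntegrable_const.add hFint) hBint,
      intervalIntegral.integral_add intervalIntegrable_const hFint]
    have : ∫ _ in (-Real.pi)..Real.pi, c = 2 * Real.sqrt 12 := by
      rw [intervalIntegral.integral_const, smul_eq_mul, hc]; field_simp; ring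
    rw [this]; linarith
  · exact ((intervalIntegrable_iff_integrableOn_Ioc_of_le (by linarith)).1 hGint).mono_set
      Set.Ioo_subset_Ioc_self
  · intro φ hφ s hs hsG
    have hzero : ∀ v ∈ T, ¬ Real.sqrt 3 * (‖v‖ / 2) < 2 * Real.cos (φ - v.arg) →
        capDefect (‖v‖ / 2) (φ - v.arg) = 0 := fun v _ h => if_neg h
    by_cases hbd : Real.sqrt 3 * (R - a) < 2 ∧ |φ| < 4 / 5
    · have hncap : ∀ v ∈ T, ¬ Real.sqrt 3 * (‖v‖ / 2) < 2 * Real.cos (φ - v.arg) :=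
        fun v hv => not_cap_of_boundary (hT v hv) (hTR v hv) hbd.1 hbd.2
      have hGφ : G φ = 1 + φ ^ 2 / 2 := by
        simp only [hG, hF, hB]
        rw [Finset.sum_eq_zero fun v hv => hzero v hv (hncap v hv),
          Set.indicator_of_mem (show φ ∈ Set.Ioo (-(4 / 5) : ℝ) (4 / 5) from abs_lt.1 hbd.2), if_pos hbd.1]
        ring
      rw [hGφ] at hsG
      have hu : φ ^ 2 ≤ 16 / 25 := by rw [← sq_abs]; nlinarith [abs_nonneg φ]
      exact ⟨norm_add_le_of_sq_add_le hR ha haR (by linarith)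
        (sq_add_two_mul_cos_le_of_small hbd.2 hsG),
        fun v hv => norm_lt_norm_sub_of_not_cap (hT v hv) hs (hncap v hv) (by linarith)⟩
    have hB0 : B φ = 0 := by
      by_cases h1 : φ ∈ Set.Ioo (-(4 / 5) : ℝ) (4 / 5)
      · rw [hB, Set.indicator_of_mem h1, if_neg fun h => hbd ⟨h, abs_lt.2 h1⟩]
      · rw [hB, Set.indicator_of_notMem h1]
    have hdisc : s ^ 2 < 4 / 3 →
        ‖(s : ℂ) * (Real.cos φ + Real.sin φ * Complex.I) + a‖ ≤ R := by
      intro hs2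
      by_cases h1 : |φ| < 4 / 5
      · have h2 : 2 ≤ Real.sqrt 3 * (R - a) := not_lt.1 fun h => hbd ⟨h, h1⟩
        have hnorm : ‖(s : ℂ) * (Real.cos φ + Real.sin φ * Complex.I)‖ = s := by
          rw [← Complex.polarCoord_symm_apply (s, φ), Complex.norm_polarCoord_symm, abs_of_pos hs]
        refine (norm_add_le _ _).trans ?_
        rw [hnorm, Complex.norm_real, Real.norm_of_nonneg ha]
        have h4 : 4 ≤ 3 * (R - a) ^ 2 := by
          have := pow_le_pow_left₀ (by norm_num) h2 2
          rw [mul_pow, Real.sq_sqrt (by norm_num)] at this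
          linarith
        nlinarith
      · exact norm_add_le_of_sq_add_le hR ha haR hs2.le
          (sq_add_two_mul_cos_le_of_large hs (not_lt.1 h1) (abs_le.2 ⟨hφ.1.le, hφ.2.le⟩) hs2)
    by_cases hcap : ∃ v ∈ T, Real.sqrt 3 * (‖v‖ / 2) < 2 * Real.cos (φ - v.arg)
    · obtain ⟨v, hv, hvc⟩ := hcap
      have hother : ∀ w ∈ T, w ≠ v → ¬ Real.sqrt 3 * (‖w‖ / 2) < 2 * Real.cos (φ - w.arg) :=
        fun w hw hwv hwc => caps_disjoint (hT w hw) (hT v hv) (hTT w hw v hv hwv) hwc hvc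
      have hGφ : G φ = (‖v‖ / 2) ^ 2 / Real.cos (φ - v.arg) ^ 2 := by
        simp only [hG, hF, hB0]
        rw [Finset.sum_eq_single_of_mem v hv fun w hw hwv => hzero w hw (hother w hw hwv),
          capDefect, if_pos hvc, ← hc]
        ring
      rw [hGφ] at hsG
      have hs2 : s ^ 2 < 4 / 3 := by
        refine hsG.trans_le ?_
        have h0 : 0 ≤ Real.sqrt 3 * (‖v‖ / 2) := by positivity
        rw [div_le_iff₀ (by nlinarith)]
        have := pow_le_pow_left₀ h0 hvc.le 2
        rw [mul_pow, Real.sq_sqrt (by norm_num)] at this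
        linarith
      refine ⟨hdisc hs2, fun w hw => ?_⟩
      by_cases hwv : w = v
      · rw [hwv]; exact norm_lt_norm_sub_of_cap (hT v hv) hvc hsG
      · exact norm_lt_norm_sub_of_not_cap (hT w hw) hs (hother w hw hwv) hs2
    · push Not at hcap
      have hGφ : G φ = c := by
        simp only [hG, hF, hB0]
        rw [Finset.sum_eq_zero fun v hv => hzero v hv (not_lt.2 (hcap v hv))]
        ring
      rw [hGφ] at hsG
      -- With no cap in this direction the cell is free of bisectors up to `2 / √3`, but radius `√c`
      -- suffices.
      have hs2 : s ^ 2 < 4 / 3 := by norm_num at hc1 ⊢; linarith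
      exact ⟨hdisc hs2,
        fun v hv => norm_lt_norm_sub_of_not_cap (hT v hv) hs (not_lt.2 (hcap v hv)) hs2⟩

/-- The part of the Voronoi cell of `x` with respect to `S` in the disc of radius `R`. -/
def voronoiCell (S : Finset ℂ) (R : ℝ) (x : ℂ) : Set ℂ :=
  {q : ℂ | ‖q‖ ≤ R} ∩ ⋂ y ∈ S.erase x, {q : ℂ | ‖q - x‖ < ‖q - y‖}

theorem measurableSet_voronoiCell (S : Finset ℂ) (R : ℝ) (x : ℂ) :
    MeasurableSet (voronoiCell S R x) :=
  (measurableSet_le (by fun_prop) (by fun_prop)).inter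
    (Finset.measurableSet_biInter _ fun v _ => measurableSet_lt (by fun_prop) (by fun_prop))

/-- A rigid motion takes `x` to `0` and the centre of the disc to `-‖x‖` on the real axis, the
position of `sqrt_twelve_le_volume_cell`. -/
theorem sqrt_twelve_le_volume_voronoiCell {S : Finset ℂ} {R : ℝ} (hR : 2 ≤ R)
    (hS : ∀ z ∈ S, ‖z‖ ≤ R - 1) (hSS : ∀ z ∈ S, ∀ w ∈ S, z ≠ w → 2 ≤ ‖z - w‖) {x : ℂ}
    (hx : x ∈ S) : ENNReal.ofReal (Real.sqrt 12) ≤ volume (voronoiCell S R x) := by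
  classical
  set w : Circle := Circle.exp x.arg with hw
  have hxw : x = w * (‖x‖ : ℂ) := by
    rw [hw, Circle.coe_exp, mul_comm, Complex.norm_mul_exp_arg_mul_I]
  have hnw : ∀ z : ℂ, ‖(w : ℂ) * z‖ = ‖z‖ := fun z => by rw [norm_mul, Circle.norm_coe, one_mul]
  have hw0 : (w : ℂ) ≠ 0 := w.coe_ne_zero
  have hf : MeasurePreserving (fun q : ℂ => x + (w : ℂ) * q) volume volume :=
    (measurePreserving_add_left volume x).comp (rotation w).measurePreserving
  rw [← hf.measure_preimage (measurableSet_voronoiCell S R x).nullMeasurableSet]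
  set T : Finset ℂ := (S.erase x).image fun y => (w : ℂ)⁻¹ * (y - x) with hT
  have hwT : ∀ y : ℂ, (w : ℂ) * ((w : ℂ)⁻¹ * (y - x)) = y - x := fun y =>
    mul_inv_cancel_left₀ hw0 _
  refine (sqrt_twelve_le_volume_cell T hR (norm_nonneg x) (hS x hx) ?_ ?_ ?_).trans
    (measure_mono ?_)
  · intro v hv
    obtain ⟨y, hy, rfl⟩ := Finset.mem_image.1 hv
    rw [← hnw, hwT]
    exact hSS y (Finset.mem_of_mem_erase hy) x hx (Finset.ne_of_mem_erase hy)
  · intro v hv v' hv' hne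
    obtain ⟨y, hy, rfl⟩ := Finset.mem_image.1 hv
    obtain ⟨y', hy', rfl⟩ := Finset.mem_image.1 hv'
    rw [← hnw, mul_sub, hwT, hwT, sub_sub_sub_cancel_right]
    exact hSS y (Finset.mem_of_mem_erase hy) y' (Finset.mem_of_mem_erase hy')
      fun h => hne (by rw [h])
  · intro v hv
    obtain ⟨y, hy, rfl⟩ := Finset.mem_image.1 hv
    rw [← hnw, mul_add, hwT, ← hxw, sub_add_cancel]
    exact hS y (Finset.mem_of_mem_erase hy)
  · rintro q ⟨hq1, hq2⟩
    refine ⟨?_, ?_⟩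
    · change ‖x + w * q‖ ≤ R
      rw [← hnw, mul_add, ← hxw] at hq1
      rwa [add_comm]
    · simp only [Set.mem_iInter]
      intro y hy
      change ‖x + w * q - x‖ < ‖x + w * q - y‖
      have := hq2 _ (Finset.mem_image_of_mem _ hy)
      rw [← hnw, ← hnw (q - _), mul_sub, hwT] at this
      rwa [add_sub_cancel_left, show x + w * q - y = w * q - (y - x) by ring]

/-- Points at mutual distance at least `2` in the disc of radius `R - 1`: the unit discs around
them cover at most the fraction `π / √12` of the disc of radius `R`. -/
theorem card_mul_sqrt_twelve_le {S : Finset ℂ} {R : ℝ} (hR : 2 ≤ R)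
    (hS : ∀ z ∈ S, ‖z‖ ≤ R - 1) (hSS : ∀ z ∈ S, ∀ w ∈ S, z ≠ w → 2 ≤ ‖z - w‖) :
    S.card * Real.sqrt 12 ≤ Real.pi * R ^ 2 := by
  have hdisj : Set.PairwiseDisjoint (S : Set ℂ) (voronoiCell S R) := by
    intro x hx y hy hxy
    rw [Function.onFun, Set.disjoint_left]
    rintro q ⟨_, hq⟩ ⟨_, hq'⟩
    simp only [Set.mem_iInter] at hq hq'
    have h1 : ‖q - x‖ < ‖q - y‖ := hq y (Finset.mem_erase.2 ⟨hxy.symm, hy⟩)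
    have h2 : ‖q - y‖ < ‖q - x‖ := hq' x (Finset.mem_erase.2 ⟨hxy, hx⟩)
    exact lt_asymm h1 h2
  have hsub : (⋃ x ∈ S, voronoiCell S R x) ⊆ Metric.closedBall 0 R := by
    intro q hq
    obtain ⟨x, _, hq⟩ := Set.mem_iUnion₂.1 hq
    exact mem_closedBall_zero_iff.2 hq.1
  have key : ENNReal.ofReal (S.card * Real.sqrt 12) ≤ ENNReal.ofReal (Real.pi * R ^ 2) := by
    calc ENNReal.ofReal (S.card * Real.sqrt 12)
        = ∑ x ∈ S, ENNReal.ofReal (Real.sqrt 12) := by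
          rw [Finset.sum_const, nsmul_eq_mul, ENNReal.ofReal_mul (Nat.cast_nonneg _),
            ENNReal.ofReal_natCast]
      _ ≤ ∑ x ∈ S, volume (voronoiCell S R x) :=
          Finset.sum_le_sum fun x hx => sqrt_twelve_le_volume_voronoiCell hR hS hSS hx
      _ = volume (⋃ x ∈ S, voronoiCell S R x) :=
          (measure_biUnion_finset hdisj fun x _ => measurableSet_voronoiCell S R x).symm
      _ ≤ volume (Metric.closedBall (0 : ℂ) R) := measure_mono hsub
      _ = ENNReal.ofReal (Real.pi * R ^ 2) := by
          rw [Complex.volume_closedBall, mul_comm, ENNReal.ofReal_mul Real.pi_nonneg,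
            ENNReal.ofReal_pow (by linarith)]
          congr 1
          rw [← ENNReal.ofReal_coe_nnreal, NNReal.coe_real_pi]
  exact (ENNReal.ofReal_le_ofReal_iff (by positivity)).1 key

/-- Scaling by `1 / H` turns separation `2H` into `2` and the radius into `r / H = R - 1`; `H ≤ r`
supplies `R ≥ 2`. -/
theorem card_le_of_separated {S : Finset Plane} {H r : ℝ} (hH : 0 < H) (hr : H ≤ r)
    (hS : ∀ x ∈ S, ‖x‖ ≤ r) (hSS : ∀ x ∈ S, ∀ y ∈ S, x ≠ y → 2 * H ≤ dist x y) :
    (S.card : ℝ) ≤ Real.pi / Real.sqrt 12 * (1 + r / H) ^ 2 := by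
  classical
  set f : Plane → ℂ := fun x => ((H⁻¹ : ℝ) : ℂ) * Complex.orthonormalBasisOneI.repr.symm x with hf
  have hdist : ∀ x y, ‖f x - f y‖ = H⁻¹ * dist x y := fun x y => by
    rw [hf, ← mul_sub, norm_mul, Complex.norm_real, Real.norm_of_nonneg (by positivity), ← map_sub,
      LinearIsometryEquiv.norm_map, dist_eq_norm]
  have hnorm : ∀ x, ‖f x‖ = H⁻¹ * ‖x‖ := fun x => by
    rw [hf, norm_mul, Complex.norm_real, Real.norm_of_nonneg (by positivity),
      LinearIsometryEquiv.norm_map]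
  have hinj : Function.Injective f := by
    intro x y hxy
    have := hdist x y
    rw [hxy, sub_self, norm_zero] at this
    have h0 := (mul_eq_zero.1 this.symm).resolve_left (by positivity)
    exact dist_eq_zero.1 h0
  have h1 : 1 ≤ r / H := (one_le_div hH).2 hr
  have key := card_mul_sqrt_twelve_le (S := S.image f) (R := 1 + r / H) (by linarith) ?_ ?_
  · rw [Finset.card_image_of_injective _ hinj] at key
    rw [div_mul_eq_mul_div, le_div_iff₀ (by positivity)]
    exact key
  · intro z hz
    obtain ⟨x, hx, rfl⟩ := Finset.mem_image.1 hz
    rw [hnorm, add_sub_cancel_left, inv_mul_eq_div]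
    exact div_le_div_of_nonneg_right (hS x hx) hH.le
  · intro z hz w hw hne
    obtain ⟨x, hx, rfl⟩ := Finset.mem_image.1 hz
    obtain ⟨y, hy, rfl⟩ := Finset.mem_image.1 hw
    rw [hdist, inv_mul_eq_div, le_div_iff₀ hH]
    exact hSS x hx y hy fun h => hne (by rw [h])

/-! ### Summation by parts against a counting bound. -/

theorem mul_sub_le_integral_antitone {ℓ F F' : ℝ → ℝ} {a b : ℝ} (ha : 0 ≤ a) (hab : a ≤ b)
    (hℓ : AntitoneOn ℓ (Set.Ici 0)) (hF : ∀ r, HasDerivAt F (F' r) r) (hF'c : Continuous F')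
    (hF' : ∀ r, 0 ≤ r → 0 ≤ F' r) :
    ℓ b * (F b - F a) ≤ ∫ r in a..b, ℓ r * F' r := by
  have hint : IntervalIntegrable ℓ volume a b := by
    refine AntitoneOn.intervalIntegrable (hℓ.mono ?_)
    rw [Set.uIcc_of_le hab]
    exact fun x hx => ha.trans hx.1
  rw [← intervalIntegral.integral_eq_sub_of_hasDerivAt (fun r _ => hF r)
    (hF'c.intervalIntegrable a b), ← intervalIntegral.integral_const_mul]
  refine intervalIntegral.integral_mono_on hab ((hF'c.intervalIntegrable a b).const_mul _)
    (hint.mul_continuousOn hF'c.continuousOn) fun r hr => ?_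
  have hr0 : 0 ≤ r := ha.trans hr.1
  exact mul_le_mul_of_nonneg_right (hℓ hr0 (hr0.trans hr.2) hr.2) (hF' r hr0)

/-- Summation by parts: if `F r` bounds the number of points of `S` at distance at most `r`, a
sum of a non-increasing function over `S` is bounded by its Stieltjes integral against `F`. -/
theorem sum_add_le_integral {ι : Type*} (S : Finset ι) (f : ι → ℝ) {ℓ F F' : ℝ → ℝ} {t : ℝ}
    (ht : 0 ≤ t) (hℓ : AntitoneOn ℓ (Set.Ici 0))
    (hF : ∀ r, HasDerivAt F (F' r) r) (hF'c : Continuous F') (hF' : ∀ r, 0 ≤ r → 0 ≤ F' r)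
    (hft : ∀ x ∈ S, t ≤ f x)
    (hcount : ∀ U ⊆ S, ∀ r, t ≤ r → (∀ x ∈ U, f x ≤ r) → (U.card : ℝ) ≤ F r) :
    ∀ b, t ≤ b → (∀ x ∈ S, f x ≤ b) →
      ∑ x ∈ S, ℓ (f x) + (F b - S.card) * ℓ b ≤ ℓ t * F t + ∫ r in t..b, ℓ r * F' r := by
  classical
  have hint : ∀ a b, 0 ≤ a → a ≤ b → IntervalIntegrable (fun r => ℓ r * F' r) volume a b := by
    intro a b ha hab
    refine IntervalIntegrable.mul_continuousOn ?_ hF'c.continuousOn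
    refine AntitoneOn.intervalIntegrable (hℓ.mono ?_)
    rw [Set.uIcc_of_le hab]
    exact fun x hx => ha.trans hx.1
  -- The farthest point `x` is split off and the induction hypothesis is used at `b = f x`. The
  -- slack `(F b - S.card) * ℓ b` absorbs the new term `ℓ (f x)`, and the counting bound at `f x`
  -- keeps it nonnegative while `b` grows back.
  induction S using Finset.induction_on_max_value f with
  | empty =>
    intro b hb _
    have h1 := mul_sub_le_integral_antitone ht hb hℓ hF hF'c hF'
    have h2 : 0 ≤ F t := by simpa using hcount ∅ (Finset.empty_subset _) t le_rfl (by simp)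
    have h3 := mul_le_mul_of_nonneg_right (hℓ ht (ht.trans hb) hb) h2
    simp only [Finset.sum_empty, Finset.card_empty, Nat.cast_zero]
    linarith
  | insert x S hx hmax ih =>
    intro b hb hSb
    have htx : t ≤ f x := hft x (Finset.mem_insert_self _ _)
    have hxb : f x ≤ b := hSb x (Finset.mem_insert_self _ _)
    have h0 := ih (fun y hy => hft y (Finset.mem_insert_of_mem hy))
      (fun U hU => hcount U (hU.trans (Finset.subset_insert _ _))) (f x) htx hmax
    have h1 := mul_sub_le_integral_antitone (ht.trans htx) hxb hℓ hF hF'c hF'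
    have h2 := hcount (insert x S) subset_rfl (f x) htx (by
      intro y hy
      rcases Finset.mem_insert.1 hy with rfl | hy
      · exact le_rfl
      · exact hmax y hy)
    have h3 := mul_le_mul_of_nonneg_left (hℓ (ht.trans htx) ((ht.trans htx).trans hxb) hxb)
      (sub_nonneg.2 h2)
    rw [← intervalIntegral.integral_add_adjacent_intervals (hint t (f x) ht htx)
      (hint (f x) b (ht.trans htx) hxb), Finset.sum_insert hx]
    rw [Finset.card_insert_of_notMem hx] at h3 ⊢
    push_cast at h3 ⊢
    linarith

theorem sum_ofReal_le_lintegral {ι : Type*} (S : Finset ι) (f : ι → ℝ) {ℓ F F' : ℝ → ℝ} {t : ℝ}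
    (ht : 0 ≤ t) (hℓ0 : ∀ r, 0 ≤ r → 0 ≤ ℓ r) (hℓ : AntitoneOn ℓ (Set.Ici 0))
    (hF : ∀ r, HasDerivAt F (F' r) r) (hF'c : Continuous F') (hF' : ∀ r, 0 ≤ r → 0 ≤ F' r)
    (hft : ∀ x ∈ S, t ≤ f x)
    (hcount : ∀ U ⊆ S, ∀ r, t ≤ r → (∀ x ∈ U, f x ≤ r) → (U.card : ℝ) ≤ F r) :
    ∑ x ∈ S, ENNReal.ofReal (ℓ (f x)) ≤
      (∫⁻ r in Set.Ioi t, ENNReal.ofReal (ℓ r * F' r)) + ENNReal.ofReal (ℓ t * F t) := by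
  obtain ⟨b, htb, hb⟩ : ∃ b, t ≤ b ∧ ∀ x ∈ S, f x ≤ b := by
    obtain ⟨M, hM⟩ := (S.image f).bddAbove
    exact ⟨max t M, le_max_left _ _, fun x hx =>
      (hM (Finset.mem_coe.2 (Finset.mem_image_of_mem f hx))).trans (le_max_right _ _)⟩
  have hmain := sum_add_le_integral S f ht hℓ hF hF'c hF' hft hcount b htb hb
  have h1 := mul_nonneg (sub_nonneg.2 (hcount S subset_rfl b htb hb)) (hℓ0 b (ht.trans htb))
  have hint : IntervalIntegrable (fun r => ℓ r * F' r) volume t b := by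
    refine IntervalIntegrable.mul_continuousOn ?_ hF'c.continuousOn
    refine AntitoneOn.intervalIntegrable (hℓ.mono ?_)
    rw [Set.uIcc_of_le htb]
    exact fun x hx => ht.trans hx.1
  rw [← ENNReal.ofReal_sum_of_nonneg fun x hx => hℓ0 _ (ht.trans (hft x hx))]
  calc ENNReal.ofReal (∑ x ∈ S, ℓ (f x))
      ≤ ENNReal.ofReal ((∫ r in t..b, ℓ r * F' r) + ℓ t * F t) :=
        ENNReal.ofReal_le_ofReal (by linarith)
    _ ≤ ENNReal.ofReal (∫ r in t..b, ℓ r * F' r) + ENNReal.ofReal (ℓ t * F t) :=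
        ENNReal.ofReal_add_le
    _ ≤ _ := by
        gcongr
        rw [intervalIntegral.integral_of_le htb, ofReal_integral_eq_lintegral_ofReal
          ((intervalIntegrable_iff_integrableOn_Ioc_of_le htb).1 hint)]
        · exact lintegral_mono_set Set.Ioc_subset_Ioi_self
        · filter_upwards [ae_restrict_mem measurableSet_Ioc] with r hr
          exact mul_nonneg (hℓ0 r (ht.trans hr.1.le)) (hF' r (ht.trans hr.1.le))

/-! ### Interference, SINR and rate. -/

theorem interference_le {K : ℕ} {A : Set Plane} {m : Plane → Fin K} {x₀ : Plane} {H : ℝ}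
    (hH : 0 < H) (hA : ∀ x ∈ A, ∀ y ∈ A, x ≠ y → m x = m y → 2 * H ≤ dist x y)
    (hx₀ : IsServing A x₀) {ℓ : ℝ → ℝ} (hℓ0 : ∀ r, 0 ≤ r → 0 ≤ ℓ r)
    (hℓ : AntitoneOn ℓ (Set.Ici 0)) {t : ℝ} (ht : t = max ‖x₀‖ (2 * H - ‖x₀‖)) :
    interference ℓ A m x₀ (m x₀) ≤
      (∫⁻ r in Set.Ioi t,
          ENNReal.ofReal (2 * Real.pi * ℓ r / Real.sqrt 12 * (1 / H + r / H ^ 2))) +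
        ENNReal.ofReal (Real.pi * ℓ t * t / Real.sqrt 12 * (2 / H + t / H ^ 2)) := by
  classical
  have hdt : ‖x₀‖ ≤ t := ht ▸ le_max_left _ _
  have hHt : H ≤ t := by
    have : 2 * H - ‖x₀‖ ≤ t := ht ▸ le_max_right _ _
    linarith
  have ht0 : 0 ≤ t := hH.le.trans hHt
  set F : ℝ → ℝ := fun r => Real.pi / Real.sqrt 12 * (2 * r / H + r ^ 2 / H ^ 2) with hF
  set F' : ℝ → ℝ := fun r => 2 * Real.pi / Real.sqrt 12 * (1 / H + r / H ^ 2) with hF'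
  have hderiv : ∀ r, HasDerivAt F (F' r) r := by
    intro r
    have h1 := (((((hasDerivAt_id r).const_mul 2).div_const H).add
      (((hasDerivAt_id r).pow 2).div_const (H ^ 2))).const_mul (Real.pi / Real.sqrt 12))
    refine h1.congr_deriv ?_
    simp only [hF', id]; push_cast; ring
  have hcongr : ∀ r, ENNReal.ofReal (2 * Real.pi * ℓ r / Real.sqrt 12 * (1 / H + r / H ^ 2)) =
      ENNReal.ofReal (ℓ r * F' r) := fun r => by congr 1; simp only [hF']; ring
  have hpi12 : Real.pi / Real.sqrt 12 ≤ 1 := by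
    rw [div_le_one (by positivity)]
    exact Real.le_sqrt_of_sq_le (by nlinarith [Real.pi_lt_d2, Real.pi_pos])
  rw [interference, ENNReal.tsum_eq_iSup_sum]
  refine iSup_le fun S => ?_
  have hmain := sum_ofReal_le_lintegral S (fun x => ‖(x : Plane)‖) ht0 hℓ0 hℓ hderiv
    (by fun_prop) (fun r hr => by positivity) ?_ ?_
  · have hFt : Real.pi * ℓ t * t / Real.sqrt 12 * (2 / H + t / H ^ 2) = ℓ t * F t := by
      simp only [hF]; ring
    rw [lintegral_congr hcongr, hFt]
    exact hmain
  · intro x _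
    obtain ⟨x, hxA, hx, hm⟩ := x
    rw [ht]
    refine max_le (hx₀.2 x hxA) ?_
    have h1 := hA x hxA x₀ hx₀.1 hx hm
    rw [dist_eq_norm] at h1
    linarith [norm_sub_le x x₀]
  · intro U _ r hr hU
    -- Adding `x₀` to the counted points gains one in the packing bound. As `π / √12 ≤ 1`, this
    -- absorbs the constant term of `π / √12 * (1 + r / H) ^ 2` and leaves `F r`.
    set V : Finset Plane := insert x₀ (U.image Subtype.val) with hV
    have hVA : ∀ x ∈ V, x ∈ A ∧ m x = m x₀ ∧ ‖x‖ ≤ r := by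
      intro x hx
      rcases Finset.mem_insert.1 hx with rfl | hx
      · exact ⟨hx₀.1, rfl, hdt.trans hr⟩
      · obtain ⟨y, hy, rfl⟩ := Finset.mem_image.1 hx
        exact ⟨y.2.1, y.2.2.2, hU y hy⟩
    have hcard : V.card = U.card + 1 := by
      rw [hV, Finset.card_insert_of_notMem, Finset.card_image_of_injective _ Subtype.val_injective]
      intro h
      obtain ⟨y, _, hy⟩ := Finset.mem_image.1 h
      exact y.2.2.1 hy
    have hle := card_le_of_separated hH (hHt.trans hr) (fun x hx => (hVA x hx).2.2)
      fun x hx y hy hxy => hA x (hVA x hx).1 y (hVA y hy).1 hxy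
        ((hVA x hx).2.1.trans (hVA y hy).2.1.symm)
    rw [hcard] at hle
    push_cast at hle
    have e : Real.pi / Real.sqrt 12 * (1 + r / H) ^ 2 = F r + Real.pi / Real.sqrt 12 := by
      simp only [hF]; ring
    linarith

theorem theta_le_sinr {K : ℕ} {A : Set Plane} {m : Plane → Fin K} {x₀ : Plane} {H P W : ℝ}
    (hH : 0 < H) (hP : 0 < P) (hW : 0 < W)
    (hA : ∀ x ∈ A, ∀ y ∈ A, x ≠ y → m x = m y → 2 * H ≤ dist x y)
    (hx₀ : IsServing A x₀) {ℓ : ℝ → ℝ} (hℓ0 : ∀ r, 0 ≤ r → 0 ≤ ℓ r)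
    (hℓ : AntitoneOn ℓ (Set.Ici 0)) :
    theta W ℓ ‖x₀‖ P H ≤ sinr P W ℓ A m x₀ (m x₀) := by
  have hW' : ENNReal.ofReal W ≠ 0 := (ENNReal.ofReal_pos.2 hW).ne'
  simp only [theta, sinr, if_true, mul_one]
  refine ENNReal.toReal_mono ?_ (ENNReal.div_le_div_left ?_ _)
  -- Since `W > 0` the denominator is nonzero, so the SINR is finite and `toReal` preserves the
  -- inequality, even when the integral or the interference is infinite.
  · exact ENNReal.div_ne_top ENNReal.ofReal_ne_top fun h => hW' (add_eq_zero.1 h).2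
  · gcongr
    refine (mul_le_mul_right (interference_le hH hA hx₀ hℓ0 hℓ rfl) _).trans_eq ?_
    rw [mul_add, ENNReal.ofReal_mul hP.le]

theorem log_le_normalizedRate {K : ℕ} {A : Set Plane} {m : Plane → Fin K} {x₀ : Plane}
    {P W θ : ℝ} {ℓ : ℝ → ℝ} (hθ : 0 ≤ θ) (i : Fin K) (h : θ ≤ sinr P W ℓ A m x₀ i) :
    (1 / (K : ℝ)) * Real.log (1 + θ) ≤ normalizedRate P W ℓ A m x₀ := by
  refine mul_le_mul_of_nonneg_left ?_ (by positivity)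
  refine (Real.log_le_log (by linarith) (by linarith)).trans
    (Finset.single_le_sum (f := fun i => Real.log (1 + sinr P W ℓ A m x₀ i)) (fun j _ => ?_)
      (Finset.mem_univ i))
  exact Real.log_nonneg (by linarith [show 0 ≤ sinr P W ℓ A m x₀ j from ENNReal.toReal_nonneg])

theorem mainTheorem4 {Ω : Type*} [MeasurableSpace Ω] (μ : Measure Ω) [IsProbabilityMeasure μ]
    (Φ : Ω → Set Plane) (K : ℕ) (hK : 1 ≤ K) (H : ℝ) (hH : 0 < H)
    (hΦ : IsHardcoreRegulated μ Φ K H)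
    (P W : ℝ) (hP : 0 < P) (hW : 0 < W)
    (ℓ : ℝ → ℝ) (hℓ_nonneg : ∀ r, 0 ≤ r → 0 ≤ ℓ r) (hℓ_anti : AntitoneOn ℓ (Set.Ici 0)) :
    ∃ M : Ω → Plane → Fin K, IsStationaryMarking μ Φ M ∧
      ∀ᵐ ω ∂μ, ∀ x₀ : Plane, IsServing (Φ ω) x₀ →
        ∀ (d : ℝ) (i : Fin K), ‖x₀‖ = d → M ω x₀ = i →
          theta W ℓ d P H ≤ sinr P W ℓ (Φ ω) (M ω) x₀ i ∧
          (1 / (K : ℝ)) * Real.log (1 + theta W ℓ d P H) ≤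
            normalizedRate P W ℓ (Φ ω) (M ω) x₀ := by
  obtain ⟨-, M, hM, hhard⟩ := hΦ
  refine ⟨M, hM, ?_⟩
  filter_upwards [hhard] with ω hω x₀ hx₀ d i hd hi
  subst hd hi
  have h := theta_le_sinr hH hP hW hω hx₀ hℓ_nonneg hℓ_anti
  exact ⟨h, log_le_normalizedRate ENNReal.toReal_nonneg _ h⟩
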